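/- **Structures.** Fix countably many positive and negative atoms, with the negation $a\mapsto\bar a$ exchanging them. Structures (in negation normal form) are generated from atoms and a unit $\circ$ by par $[R,T]$, times $(R,T)$, seq $\langle R;T\rangle$, $?R$ and $!R$. They are considered modulo the congruence $=$ generated by: par, times and seq are associative, par and times are commutative, and $\circ$ is a (two-sided) unit of all three. $S\{\ \}$ denotes a structure with a hole. **System SNEL.** It consists of the rules "from the premise $S\{W\}$ infer the conclusion $S\{Z\}$" (written $W\to Z$; $W$ is the contractum, $Z$ the redex), for all contexts $S\{\ \}$, all atoms $a$ and all structures $R,T,U,V$: - $\mathsf{ai}{\downarrow}$: $\circ\to[a,\bar a]$; $\mathsf{ai}{\uparrow}$: $(a,\bar a)\to\circ$; $\mathsf{s}$: $([R,U],T)\to[(R,T),U]$; - $\mathsf{q}{\downarrow}$: $\langle[R,U];[T,V]\rangle\to[\langle R;T\rangle,\langle U;V\rangle]$; $\mathsf{q}{\uparrow}$: $(\langle R;U\rangle,\langle T;V\rangle)\to\langle(R,T);(U,V)\rangle$; - $\mathsf{p}{\downarrow}$: $![R,T]\to[!R,?T]$; $\mathsf{p}{\uparrow}$: $(?T,!R)\to{?}(T,R)$;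 $\mathsf{e}{\downarrow}$: $\circ\to{!}\circ$; $\mathsf{e}{\uparrow}$: $?\circ\to\circ$; - $\mathsf{w}{\downarrow}$: $\circ\to{?}T$; $\mathsf{w}{\uparrow}$: $!R\to\circ$; $\mathsf{b}{\downarrow}$: $[?T,T]\to{?}T$; $\mathsf{b}{\uparrow}$: $!R\to(!R,R)$; $\mathsf{g}{\downarrow}$: $??T\to{?}T$; $\mathsf{g}{\uparrow}$: $!R\to{!!}R$. A derivation is a finite chain of structures, written from top to bottom, in which each structure yields the next one by an instance of a rule. Occurrences of substructures are followed through the equations. **Flow graph.** The !-?-flow-graph of a derivation $\Delta$ is the directed graph whose vertices are the occurrences of $!$- and $?$-substructures in $\Delta$ and whose edges come from the rule instances, as follows. Say that an occurrence in the premise and one in the conclusion *correspond* if they are the same occurrence in (or above the hole of) the context, or the same occurrence inside copies of the same schematic variable of the rule (for $\mathsf b{\uparrow}$ and $\mathsf b{\downarrow}$ an occurrence inside $R$, respectively $T$, thus has two counterparts), or one of the following displayed modalities: in $\mathsf p{\downarrow}$, $![R,T]$ and $!R$; in $\mathsf p{\uparrow}$, $?T$ and $?(T,R)$; in $\mathsf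 b{\uparrow}$, the two displayed $!R$; in $\mathsf b{\downarrow}$, the two displayed $?T$; in $\mathsf g{\uparrow}$, the $!R$ of the premise and each of the two displayed $!$-structures $!!R$, $!R$ of the conclusion; in $\mathsf g{\downarrow}$, each of $??T$, $?T$ in the premise and the $?T$ of the conclusion. Corresponding $!$-occurrences are joined by an edge upwards (from conclusion to premise), corresponding $?$-occurrences by an edge downwards (from premise to conclusion). In addition, each instance of $\mathsf p{\downarrow}$ gives an edge from $!R$ to $?T$ in its redex $[!R,?T]$, and each instance of $\mathsf p{\uparrow}$ gives an edge from $?T$ to $!R$ in its contractum $(?T,!R)$. A cycle is a path $V_0,\dots,V_n$ in this graph with $n\ge1$ and $V_0=V_n$. An instance of $\mathsf b{\uparrow}$ (respectively $\mathsf b{\downarrow}$) *forks* the cycle if both copies of $R$ in its redex $(!R,R)$ (respectively both copies of $T$ in its contractum $[?T,T]$) contain vertices of the cycle. The cycle is *unforked* if no instance of $\mathsf b{\uparrow}$ or $\mathsf b{\downarrow}$ in $\Delta$ forks it. **Theorem 4.12.** There is no derivation $\Delta$ in SNEL whose !-?-flow-graph contains an unforked cycle. -/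

import Mathlib

namespace SNEL

/-- There are countably many positive atoms `⟨n, true⟩` and negative atoms `⟨n, false⟩`. -/
structure Atom where
  idx : ℕ
  sign : Bool

/-- The negation of an atom. -/
def Atom.neg (a : Atom) : Atom := ⟨a.idx, !a.sign⟩

/-- Structures of the language `NEL`, with negation pushed to the atoms.  The `n`-ary
`[S₁, …, Sₕ]`, `(S₁, …, Sₕ)` and `⟨S₁; …; Sₕ⟩` are iterated binary ones, the bracketing being
immaterial because of the associativity and unit equations (`Eqn` below). -/
inductive Struct where
  | atom (a : Atom)
  /-- the unit `∘` -/
  | unit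
  /-- par `[R, T]` -/
  | par (R T : Struct)
  /-- times `(R, T)` -/
  | times (R T : Struct)
  /-- seq `⟨R; T⟩` (non-commutative) -/
  | seq (R T : Struct)
  /-- `? R` -/
  | quest (R : Struct)
  /-- `! R` -/
  | bang (R : Struct)

/-- One step from a structure to an immediate substructure. -/
inductive Dir where
  | left
  | right
  /-- below a modality -/
  | inner

/-- An occurrence of a substructure is given by the path that leads to it from the root. -/
abbrev Pos := List Dir

/-- The substructure at a position, if there is one. -/
def Struct.subAt : Struct → Pos → Option Struct
  | S, [] => some S
  | .par R _, .left :: p => R.subAt p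
  | .par _ T, .right :: p => T.subAt p
  | .times R _, .left :: p => R.subAt p
  | .times _ T, .right :: p => T.subAt p
  | .seq R _, .left :: p => R.subAt p
  | .seq _ T, .right :: p => T.subAt p
  | .quest R, .inner :: p => R.subAt p
  | .bang R, .inner :: p => R.subAt p
  | _, _ => none

/-- Contexts: structures with one hole. -/
inductive Ctx where
  | hole
  | parL (C : Ctx) (T : Struct)
  | parR (R : Struct) (C : Ctx)
  | timesL (C : Ctx) (T : Struct)
  | timesR (R : Struct) (C : Ctx)
  | seqL (C : Ctx) (T : Struct)
  | seqR (R : Struct) (C : Ctx)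
  | quest (C : Ctx)
  | bang (C : Ctx)

/-- `C.fill Z` is `C{Z}`. -/
def Ctx.fill : Ctx → Struct → Struct
  | .hole, Z => Z
  | .parL C T, Z => .par (C.fill Z) T
  | .parR R C, Z => .par R (C.fill Z)
  | .timesL C T, Z => .times (C.fill Z) T
  | .timesR R C, Z => .times R (C.fill Z)
  | .seqL C T, Z => .seq (C.fill Z) T
  | .seqR R C, Z => .seq R (C.fill Z)
  | .quest C, Z => .quest (C.fill Z)
  | .bang C, Z => .bang (C.fill Z)

/-- The position of the hole of a context. -/
def Ctx.path : Ctx → Pos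
  | .hole => []
  | .parL C _ => .left :: C.path
  | .parR _ C => .right :: C.path
  | .timesL C _ => .left :: C.path
  | .timesR _ C => .right :: C.path
  | .seqL C _ => .left :: C.path
  | .seqR _ C => .right :: C.path
  | .quest C => .inner :: C.path
  | .bang C => .inner :: C.path

/-- The rules of system `SNEL`. -/
inductive Rule where
  | aiDown | aiUp
  | s
  | qDown | qUp
  | pDown | pUp
  | eDown | eUp
  | wDown | wUp
  | bDown | bUp
  | gDown | gUp

open Struct in
/-- `ρ.Inst W Z`: the rule `ρ` has an instance with contractum `W` (upper, in the premise) and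
redex `Z` (lower, in the conclusion). -/
inductive Rule.Inst : Rule → Struct → Struct → Prop where
  | aiDown (a : Atom) : Inst .aiDown unit (par (atom a) (atom a.neg))
  | aiUp (a : Atom) : Inst .aiUp (times (atom a) (atom a.neg)) unit
  | s (R T U : Struct) : Inst .s (times (par R U) T) (par (times R T) U)
  | qDown (R T U V : Struct) :
      Inst .qDown (seq (par R U) (par T V)) (par (seq R T) (seq U V))
  | qUp (R T U V : Struct) :
      Inst .qUp (times (seq R U) (seq T V)) (seq (times R T) (times U V))
  | pDown (R T : Struct) : Inst .pDown (bang (par R T)) (par (bang R) (quest T))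
  | pUp (T R : Struct) : Inst .pUp (times (quest T) (bang R)) (quest (times T R))
  | eDown : Inst .eDown unit (bang unit)
  | eUp : Inst .eUp (quest unit) unit
  | wDown (T : Struct) : Inst .wDown unit (quest T)
  | wUp (R : Struct) : Inst .wUp (bang R) unit
  | bDown (T : Struct) : Inst .bDown (par (quest T) T) (quest T)
  | bUp (R : Struct) : Inst .bUp (bang R) (times (bang R) R)
  | gDown (T : Struct) : Inst .gDown (quest (quest T)) (quest T)
  | gUp (R : Struct) : Inst .gUp (bang R) (bang (bang R))

/-- The two ends of each metavariable of a rule: `(u, v)` says that the structure at position `u`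
of the contractum is (a copy of) the structure at position `v` of the redex. -/
def Rule.blocks : Rule → List (Pos × Pos)
  | .s => [([.left, .left], [.left, .left]), ([.right], [.left, .right]),
      ([.left, .right], [.right])]
  | .qDown => [([.left, .left], [.left, .left]), ([.right, .left], [.left, .right]),
      ([.left, .right], [.right, .left]), ([.right, .right], [.right, .right])]
  | .qUp => [([.left, .left], [.left, .left]), ([.right, .left], [.left, .right]),
      ([.left, .right], [.right, .left]), ([.right, .right], [.right, .right])]
  | .pDown => [([.inner, .left], [.left, .inner]), ([.inner, .right], [.right, .inner])]
  | .pUp => [([.left, .inner], [.inner, .left]), ([.right, .inner], [.inner, .right])]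
  | .bDown => [([.left, .inner], [.inner]), ([.right], [.inner])]
  | .bUp => [([.inner], [.left, .inner]), ([.inner], [.right])]
  | .gDown => [([.inner, .inner], [.inner])]
  | .gUp => [([.inner], [.inner, .inner])]
  | _ => []

/-- The pairs (position in the contractum, position in the redex) of those modalities, displayed
in the scheme of the rule, between which the flow graph has a vertical edge. -/
def Rule.modalities : Rule → List (Pos × Pos)
  | .pDown => [([], [.left])]
  | .pUp => [([.left], [])]
  | .bDown => [([.left], [])]
  | .bUp => [([], [.left])]
  | .gDown => [([], []), ([.inner], [])]
  | .gUp => [([], []), ([], [.inner])]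
  | _ => []

/-- The equations that generate the syntactic equivalence `=` of structures (as a congruence). -/
inductive Eqn where
  | parAssoc | timesAssoc | seqAssoc
  | parComm | timesComm
  | parUnit | timesUnit | seqUnitL | seqUnitR

open Struct in
/-- The left and the right hand side of an equation. -/
inductive Eqn.Inst : Eqn → Struct → Struct → Prop where
  | parAssoc (R T U : Struct) : Inst .parAssoc (par (par R T) U) (par R (par T U))
  | timesAssoc (R T U : Struct) : Inst .timesAssoc (times (times R T) U) (times R (times T U))
  | seqAssoc (R T U : Struct) : Inst .seqAssoc (seq (seq R T) U) (seq R (seq T U))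
  | parComm (R T : Struct) : Inst .parComm (par R T) (par T R)
  | timesComm (R T : Struct) : Inst .timesComm (times R T) (times T R)
  | parUnit (R : Struct) : Inst .parUnit (par unit R) R
  | timesUnit (R : Struct) : Inst .timesUnit (times unit R) R
  | seqUnitL (R : Struct) : Inst .seqUnitL (seq unit R) R
  | seqUnitR (R : Struct) : Inst .seqUnitR (seq R unit) R

/-- The two ends of each metavariable of an equation. -/
def Eqn.blocks : Eqn → List (Pos × Pos)
  | .parAssoc | .timesAssoc | .seqAssoc =>
      [([.left, .left], [.left]), ([.left, .right], [.right, .left]),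
        ([.right], [.right, .right])]
  | .parComm | .timesComm => [([.left], [.right]), ([.right], [.left])]
  | .parUnit | .timesUnit | .seqUnitL => [([.right], [])]
  | .seqUnitR => [([.left], [])]

/-- What a single step of a derivation does: it applies a rule of `SNEL`, or it rewrites a
substructure by an equation, in one of its two directions (the "fake inference rule" `=`).  In
this way structures are taken modulo `=`, while every occurrence can be followed. -/
inductive Label where
  | rule (r : Rule)
  | eqn (e : Eqn)
  | eqnSymm (e : Eqn)

/-- `l.Inst W Z`: the step replaces `W` (in the premise) by `Z` (in the conclusion). -/
def Label.Inst : Label → Struct → Struct → Prop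
  | .rule r, W, Z => r.Inst W Z
  | .eqn e, W, Z => e.Inst W Z
  | .eqnSymm e, W, Z => e.Inst Z W

def Label.blocks : Label → List (Pos × Pos)
  | .rule r => r.blocks
  | .eqn e => e.blocks
  | .eqnSymm e => e.blocks.map Prod.swap

def Label.modalities : Label → List (Pos × Pos)
  | .rule r => r.modalities
  | _ => []

/-- Position `p` of the contractum and position `q` of the redex belong to each other: they are
two ends of a displayed modality, or the same position inside (copies of) one metavariable. -/
def Label.Link (l : Label) (p q : Pos) : Prop :=
  (p, q) ∈ l.modalities ∨ ∃ b ∈ l.blocks, ∃ t : Pos, p = b.1 ++ t ∧ q = b.2 ++ t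

/-- An instance `S{Z}` below `S{W}` of a rule or an equation, with premise `P = S{W}` and
conclusion `Q = S{Z}`. -/
structure Inference (P Q : Struct) where
  label : Label
  ctx : Ctx
  contractum : Struct
  redex : Struct
  inst : label.Inst contractum redex
  premise_eq : P = ctx.fill contractum
  conclusion_eq : Q = ctx.fill redex

/-- Position `p` of the premise and position `q` of the conclusion belong to each other: they are
the same position in the context (outside the hole, possibly above it), or they lie in the
contractum and in the redex and belong to each other there. -/
def Inference.Link {P Q : Struct} (ρ : Inference P Q) (p q : Pos) : Prop :=
  (p = q ∧ ¬ ρ.ctx.path <+: p) ∨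
    ∃ p' q' : Pos, p = ρ.ctx.path ++ p' ∧ q = ρ.ctx.path ++ q' ∧ ρ.label.Link p' q'

/-- A derivation in `SNEL`, read from top to bottom: `line 0` is its premise, the last line its
conclusion, and `step i` leads from line `i` down to line `i + 1`. -/
structure Derivation where
  len : ℕ
  line : Fin (len + 1) → Struct
  step : (i : Fin len) → Inference (line i.castSucc) (line i.succ)

/-- The vertices of the `!`-`?`-flow-graph: the occurrences of `!`- and `?`-substructures in the
lines of the derivation. -/
structure Vertex (Δ : Derivation) where
  line : Fin (Δ.len + 1)
  pos : Pos
  isModal : ∃ R : Struct, (Δ.line line).subAt pos = some (.bang R) ∨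
    (Δ.line line).subAt pos = some (.quest R)

def Vertex.IsBang {Δ : Derivation} (v : Vertex Δ) : Prop :=
  ∃ R : Struct, (Δ.line v.line).subAt v.pos = some (.bang R)

def Vertex.IsQuest {Δ : Derivation} (v : Vertex Δ) : Prop :=
  ∃ R : Struct, (Δ.line v.line).subAt v.pos = some (.quest R)

/-- The edges of the `!`-`?`-flow-graph. -/
inductive Edge (Δ : Derivation) : Vertex Δ → Vertex Δ → Prop where
  /-- `!`-vertices are connected upwards, from the conclusion to the premise of a step -/
  | up (i : Fin Δ.len) (u v : Vertex Δ) (hu : u.line = i.succ) (hv : v.line = i.castSucc)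
      (hub : u.IsBang) (hvb : v.IsBang) (h : (Δ.step i).Link v.pos u.pos) : Edge Δ u v
  /-- `?`-vertices are connected downwards, from the premise to the conclusion of a step -/
  | down (i : Fin Δ.len) (u v : Vertex Δ) (hu : u.line = i.castSucc) (hv : v.line = i.succ)
      (huq : u.IsQuest) (hvq : v.IsQuest) (h : (Δ.step i).Link u.pos v.pos) : Edge Δ u v
  /-- in the redex `[!R, ?T]` of `p↓` there is an edge from `!R` to `?T` -/
  | flipDown (i : Fin Δ.len) (u v : Vertex Δ) (hl : (Δ.step i).label = .rule .pDown)
      (hu : u.line = i.succ) (hv : v.line = i.succ)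
      (hup : u.pos = (Δ.step i).ctx.path ++ [.left])
      (hvp : v.pos = (Δ.step i).ctx.path ++ [.right]) : Edge Δ u v
  /-- in the contractum `(?T, !R)` of `p↑` there is an edge from `?T` to `!R` -/
  | flipUp (i : Fin Δ.len) (u v : Vertex Δ) (hl : (Δ.step i).label = .rule .pUp)
      (hu : u.line = i.castSucc) (hv : v.line = i.castSucc)
      (hup : u.pos = (Δ.step i).ctx.path ++ [.left])
      (hvp : v.pos = (Δ.step i).ctx.path ++ [.right]) : Edge Δ u v

/-- A path `V₀, …, Vₙ` in the `!`-`?`-flow-graph. -/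
structure FlowPath (Δ : Derivation) where
  length : ℕ
  vertex : Fin (length + 1) → Vertex Δ
  edge : ∀ i : Fin length, Edge Δ (vertex i.castSucc) (vertex i.succ)

/-- A cycle: a path with at least one edge whose first and last vertex are identical. -/
structure FlowCycle (Δ : Derivation) extends FlowPath Δ where
  length_pos : 0 < length
  closed : vertex 0 = vertex (Fin.last length)

/-- The cycle has a vertex in line `k`, inside the substructure at position `p`
(that substructure itself included). -/
def FlowCycle.Meets {Δ : Derivation} (c : FlowCycle Δ) (k : Fin (Δ.len + 1)) (p : Pos) : Prop :=
  ∃ j, (c.vertex j).line = k ∧ p <+: (c.vertex j).pos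

/-- Step `i` forks the cycle: it is an instance of `b↑` and both copies of `R` in its redex
`(!R, R)` contain vertices of the cycle, or it is an instance of `b↓` and both copies of `T` in
its contractum `[?T, T]` contain vertices of the cycle. -/
def FlowCycle.ForkedBy {Δ : Derivation} (c : FlowCycle Δ) (i : Fin Δ.len) : Prop :=
  ((Δ.step i).label = .rule .bUp ∧
    c.Meets i.succ ((Δ.step i).ctx.path ++ [.left, .inner]) ∧
    c.Meets i.succ ((Δ.step i).ctx.path ++ [.right])) ∨
  ((Δ.step i).label = .rule .bDown ∧
    c.Meets i.castSucc ((Δ.step i).ctx.path ++ [.left, .inner]) ∧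
    c.Meets i.castSucc ((Δ.step i).ctx.path ++ [.right]))

/-- The forking number: the number of instances of `b↑` and `b↓` that fork the cycle. -/
noncomputable def FlowCycle.forkingNumber {Δ : Derivation} (c : FlowCycle Δ) : ℕ :=
  {i : Fin Δ.len | c.ForkedBy i}.ncard

/-- A cycle is unforked if its forking number is `0`. -/
def FlowCycle.Unforked {Δ : Derivation} (c : FlowCycle Δ) : Prop :=
  c.forkingNumber = 0

end SNEL

namespace SNEL

/-! Marking the vertices of a cycle gives every line a value in `{-1, 0, 1}`: atoms and the unit
count `0`, par, times and seq act as on coherence values, a marked `!R` counts as `1` times `R`, and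
a marked `?T` as `-1` par `T`. Thus the two ends of a turn behave like dual atoms with opposite
values, and the turn itself like an interaction rule.

Two facts carry the argument. A value is `0` only if no modality is marked, since nonzero values
never cancel (`Struct.not_mark_of_val_eq_zero`). And the value never decreases from premise to
conclusion if the step does not fork the cycle (`Label.Flow.val_le`, lifted through contexts by
`Ctx.val_fill_le`). Forking matters only for `b↑` and `b↓`: duplication is not monotone for these
values, but if one copy carries no mark it has value `0`, which is neutral.

A cycle cannot visit the first or the last line, because each of its vertices is continued through a
step above and through a step below. Hence the value is `0` at both ends, so by monotonicity `0`
everywhere, and no vertex of the cycle can exist. -/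

/-! ### Coherence values

Two experiments on a derivation, which differ exactly on a set of marked modalities, are compared
in every line by coherence: `1` is strict coherence, `0` equality, `-1` strict incoherence. -/

/-- Coherence in a par of coherence spaces. -/
def parVal (x y : SignType) : SignType := if x = 1 ∨ y = 1 then 1 else min x y

/-- Coherence in a tensor product of coherence spaces. -/
def timesVal (x y : SignType) : SignType := if x = -1 ∨ y = -1 then -1 else max x y

/-- Coherence in the sequential composition of coherence spaces. -/
def seqVal (x y : SignType) : SignType := if x = 0 then y else x

lemma parVal_mono : ∀ {x x' y y' : SignType}, x ≤ x' → y ≤ y' → parVal x y ≤ parVal x' y' := by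
  decide

lemma timesVal_mono : ∀ {x x' y y' : SignType},
    x ≤ x' → y ≤ y' → timesVal x y ≤ timesVal x' y' := by
  decide

lemma seqVal_mono : ∀ {x x' y y' : SignType}, x ≤ x' → y ≤ y' → seqVal x y ≤ seqVal x' y' := by
  decide

/-- Opposite values never cancel, so a nonzero component always remains visible in the whole. -/
lemma parVal_eq_zero : ∀ {x y : SignType}, parVal x y = 0 ↔ x = 0 ∧ y = 0 := by decide

lemma timesVal_eq_zero : ∀ {x y : SignType}, timesVal x y = 0 ↔ x = 0 ∧ y = 0 := by decide

lemma seqVal_eq_zero : ∀ {x y : SignType}, seqVal x y = 0 ↔ x = 0 ∧ y = 0 := by decide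

lemma parVal_assoc : ∀ x y z : SignType, parVal (parVal x y) z = parVal x (parVal y z) := by
  decide

lemma timesVal_assoc : ∀ x y z : SignType,
    timesVal (timesVal x y) z = timesVal x (timesVal y z) := by
  decide

lemma seqVal_assoc : ∀ x y z : SignType, seqVal (seqVal x y) z = seqVal x (seqVal y z) := by
  decide

lemma parVal_comm : ∀ x y : SignType, parVal x y = parVal y x := by decide

lemma timesVal_comm : ∀ x y : SignType, timesVal x y = timesVal y x := by decide

lemma zero_parVal : ∀ x : SignType, parVal 0 x = x := by decide

lemma zero_timesVal : ∀ x : SignType, timesVal 0 x = x := by decide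

lemma parVal_zero : ∀ x : SignType, parVal x 0 = x := by decide

lemma timesVal_zero : ∀ x : SignType, timesVal x 0 = x := by decide

lemma zero_seqVal : ∀ x : SignType, seqVal 0 x = x := by decide

lemma seqVal_zero : ∀ x : SignType, seqVal x 0 = x := by decide

/-- For `u = 1` the right side is `1`, and for `u = 0` the two sides agree. For `u = -1` the left
side is `-1` unless `r = 1`, and then both sides are `timesVal 1 t`. -/
lemma switch_le : ∀ r t u : SignType,
    timesVal (parVal r u) t ≤ parVal (timesVal r t) u := by
  decide

/-- If `r = u = 0`, both sides are `parVal t v`. Otherwise the left side is `parVal r u`; the right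
side is `1` if `r` or `u` is `1`, and in the remaining cases the left side is already `-1`. -/
lemma seqVal_parVal_le : ∀ r t u v : SignType,
    seqVal (parVal r u) (parVal t v) ≤ parVal (seqVal r t) (seqVal u v) := by
  decide

lemma timesVal_seqVal_le : ∀ r t u v : SignType,
    timesVal (seqVal r u) (seqVal t v) ≤ seqVal (timesVal r t) (timesVal u v) := by
  decide

/-! ### Values of marked structures -/

open Classical in
/-- The coherence value of a `!`-structure, depending on whether the modality is marked. -/
noncomputable def bangVal (m : Prop) (r : SignType) : SignType := if m then timesVal 1 r else r

open Classical in
/-- The coherence value of a `?`-structure, depending on whether the modality is marked. -/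
noncomputable def questVal (m : Prop) (r : SignType) : SignType :=
  if m then parVal (-1) r else r

/-- The coherence value of a structure in which the modalities at the positions in `M` are
marked. -/
noncomputable def Struct.val : Struct → (Pos → Prop) → SignType
  | .atom _, _ => 0
  | .unit, _ => 0
  | .par R T, M => parVal (R.val fun p => M (.left :: p)) (T.val fun p => M (.right :: p))
  | .times R T, M => timesVal (R.val fun p => M (.left :: p)) (T.val fun p => M (.right :: p))
  | .seq R T, M => seqVal (R.val fun p => M (.left :: p)) (T.val fun p => M (.right :: p))
  | .quest R, M => questVal (M []) (R.val fun p => M (.inner :: p))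
  | .bang R, M => bangVal (M []) (R.val fun p => M (.inner :: p))

lemma bangVal_mono {m : Prop} {r r' : SignType} (h : r ≤ r') : bangVal m r ≤ bangVal m r' := by
  unfold bangVal
  split_ifs
  · exact timesVal_mono le_rfl h
  · exact h

lemma questVal_mono {m : Prop} {r r' : SignType} (h : r ≤ r') :
    questVal m r ≤ questVal m r' := by
  unfold questVal
  split_ifs
  · exact parVal_mono le_rfl h
  · exact h

lemma bangVal_eq_zero {m : Prop} {r : SignType} : bangVal m r = 0 ↔ ¬ m ∧ r = 0 := by
  unfold bangVal
  split_ifs with h <;> simp [h, timesVal_eq_zero]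

lemma questVal_eq_zero {m : Prop} {r : SignType} : questVal m r = 0 ↔ ¬ m ∧ r = 0 := by
  unfold questVal
  split_ifs with h <;> simp [h, parVal_eq_zero]

lemma Struct.val_eq_zero (S : Struct) {M : Pos → Prop} (h : ∀ p, ¬ M p) : S.val M = 0 := by
  induction S generalizing M with
  | atom a => rfl
  | unit => rfl
  | par R T hR hT => exact parVal_eq_zero.2 ⟨hR fun _ => h _, hT fun _ => h _⟩
  | times R T hR hT => exact timesVal_eq_zero.2 ⟨hR fun _ => h _, hT fun _ => h _⟩
  | seq R T hR hT => exact seqVal_eq_zero.2 ⟨hR fun _ => h _, hT fun _ => h _⟩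
  | quest R hR => exact questVal_eq_zero.2 ⟨h _, hR fun _ => h _⟩
  | bang R hR => exact bangVal_eq_zero.2 ⟨h _, hR fun _ => h _⟩

/-- Value `0` passes to all components, and a marked modality never has value `0`. The position has
to be that of a modality because `val` ignores marks elsewhere. -/
lemma Struct.not_mark_of_val_eq_zero {S : Struct} {M : Pos → Prop} (h : S.val M = 0) {p : Pos}
    (hp : ∃ R : Struct, S.subAt p = some (.bang R) ∨ S.subAt p = some (.quest R)) : ¬ M p := by
  induction S generalizing M p with
  | atom a => rcases p with _ | ⟨_ | _ | _, p⟩ <;> simp [subAt] at hp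
  | unit => rcases p with _ | ⟨_ | _ | _, p⟩ <;> simp [subAt] at hp
  | par R T hR hT =>
    obtain ⟨h₁, h₂⟩ := parVal_eq_zero.1 h
    rcases p with _ | ⟨_ | _ | _, p⟩ <;> simp only [subAt] at hp
    · simp at hp
    · exact hR h₁ hp
    · exact hT h₂ hp
    · simp at hp
  | times R T hR hT =>
    obtain ⟨h₁, h₂⟩ := timesVal_eq_zero.1 h
    rcases p with _ | ⟨_ | _ | _, p⟩ <;> simp only [subAt] at hp
    · simp at hp
    · exact hR h₁ hp
    · exact hT h₂ hp
    · simp at hp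
  | seq R T hR hT =>
    obtain ⟨h₁, h₂⟩ := seqVal_eq_zero.1 h
    rcases p with _ | ⟨_ | _ | _, p⟩ <;> simp only [subAt] at hp
    · simp at hp
    · exact hR h₁ hp
    · exact hT h₂ hp
    · simp at hp
  | quest R hR =>
    obtain ⟨h₁, h₂⟩ := questVal_eq_zero.1 h
    rcases p with _ | ⟨_ | _ | _, p⟩ <;> simp only [subAt] at hp
    · exact h₁
    · simp at hp
    · simp at hp
    · exact hR h₂ hp
  | bang R hR =>
    obtain ⟨h₁, h₂⟩ := bangVal_eq_zero.1 h
    rcases p with _ | ⟨_ | _ | _, p⟩ <;> simp only [subAt] at hp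
    · exact h₁
    · simp at hp
    · simp at hp
    · exact hR h₂ hp

/-- All the operations are monotone, and the marks outside the hole, including those on modalities
above it, agree. -/
lemma Ctx.val_fill_le (C : Ctx) {W Z : Struct} {M N : Pos → Prop}
    (hctx : ∀ p, ¬ C.path <+: p → (M p ↔ N p))
    (hval : W.val (fun p => M (C.path ++ p)) ≤ Z.val (fun p => N (C.path ++ p))) :
    (C.fill W).val M ≤ (C.fill Z).val N := by
  induction C generalizing M N with
  | hole => exact hval
  | parL C T ih =>
    have h : (fun p => M (.right :: p)) = fun p => N (.right :: p) :=
      funext fun p => propext (hctx _ (by simp [path]))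
    refine parVal_mono (ih (fun p hp => hctx _ ?_) hval) (by rw [h])
    simpa [path] using hp
  | parR R C ih =>
    have h : (fun p => M (.left :: p)) = fun p => N (.left :: p) :=
      funext fun p => propext (hctx _ (by simp [path]))
    refine parVal_mono (by rw [h]) (ih (fun p hp => hctx _ ?_) hval)
    simpa [path] using hp
  | timesL C T ih =>
    have h : (fun p => M (.right :: p)) = fun p => N (.right :: p) :=
      funext fun p => propext (hctx _ (by simp [path]))
    refine timesVal_mono (ih (fun p hp => hctx _ ?_) hval) (by rw [h])
    simpa [path] using hp
  | timesR R C ih =>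
    have h : (fun p => M (.left :: p)) = fun p => N (.left :: p) :=
      funext fun p => propext (hctx _ (by simp [path]))
    refine timesVal_mono (by rw [h]) (ih (fun p hp => hctx _ ?_) hval)
    simpa [path] using hp
  | seqL C T ih =>
    have h : (fun p => M (.right :: p)) = fun p => N (.right :: p) :=
      funext fun p => propext (hctx _ (by simp [path]))
    refine seqVal_mono (ih (fun p hp => hctx _ ?_) hval) (by rw [h])
    simpa [path] using hp
  | seqR R C ih =>
    have h : (fun p => M (.left :: p)) = fun p => N (.left :: p) :=
      funext fun p => propext (hctx _ (by simp [path]))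
    refine seqVal_mono (by rw [h]) (ih (fun p hp => hctx _ ?_) hval)
    simpa [path] using hp
  | quest C ih =>
    have h : M [] = N [] := propext (hctx _ (by simp [path]))
    have := ih (M := fun p => M (.inner :: p)) (N := fun p => N (.inner :: p))
      (fun p hp => hctx _ (by simpa [path] using hp)) hval
    simp only [fill, Struct.val, h]
    exact questVal_mono this
  | bang C ih =>
    have h : M [] = N [] := propext (hctx _ (by simp [path]))
    have := ih (M := fun p => M (.inner :: p)) (N := fun p => N (.inner :: p))
      (fun p hp => hctx _ (by simpa [path] using hp)) hval
    simp only [fill, Struct.val, h]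
    exact bangVal_mono this

/-! ### Single steps -/

/-- The marks `M` in the contractum and `N` in the redex of a step are those of a flow: every mark
is continued on the other side, or it belongs to the pair of modalities at which a flow turns
around. -/
structure Label.Flow (l : Label) (M N : Pos → Prop) : Prop where
  down : ∀ p, M p → (∃ q, l.Link p q ∧ N q) ∨
    (l = .rule .pUp ∧ (p = [.left] ∧ M [.right] ∨ p = [.right] ∧ M [.left]))
  up : ∀ q, N q → (∃ p, l.Link p q ∧ M p) ∨
    (l = .rule .pDown ∧ (q = [.left] ∧ N [.right] ∨ q = [.right] ∧ N [.left]))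

/-- The marks `M` in the contractum and `N` in the redex are not on both copies of the
metavariable of an absorption rule. -/
structure Label.NotForked (l : Label) (M N : Pos → Prop) : Prop where
  bUp : l = .rule .bUp → (∀ t, ¬ N (.left :: .inner :: t)) ∨ ∀ t, ¬ N (.right :: t)
  bDown : l = .rule .bDown → (∀ t, ¬ M (.left :: .inner :: t)) ∨ ∀ t, ¬ M (.right :: t)

/-- With nothing linked across the step and no turn available, any mark would be a dead end. -/
lemma Label.Flow.empty {l : Label} {M N : Pos → Prop} (h : l.Flow M N)
    (hm : l.modalities = []) (hb : l.blocks = []) (hU : l ≠ .rule .pUp) (hD : l ≠ .rule .pDown) :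
    (∀ p, ¬ M p) ∧ ∀ q, ¬ N q := by
  constructor
  · intro p hp
    rcases h.down p hp with ⟨q, hl, -⟩ | ⟨hl, -⟩
    · simp [Link, hm, hb] at hl
    · exact hU hl
  · intro p hp
    rcases h.up p hp with ⟨q, hl, -⟩ | ⟨hl, -⟩
    · simp [Link, hm, hb] at hl
    · exact hD hl

/-- Equations have neither displayed modalities nor turns, so the conditions on a flow are symmetric
in premise and conclusion. -/
lemma Label.Flow.eqnSymm {e : Eqn} {M N : Pos → Prop} (h : (Label.eqnSymm e).Flow M N) :
    (Label.eqn e).Flow N M := by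
  have key : ∀ p q, (Label.eqnSymm e).Link p q → (Label.eqn e).Link q p := by
    rintro p q (hl | ⟨b, hb, t, hp, hq⟩)
    · simp [modalities] at hl
    · obtain ⟨b', hb', rfl⟩ := List.mem_map.1 hb
      exact Or.inr ⟨b', hb', t, hq, hp⟩
  constructor
  · intro p hp
    rcases h.up p hp with ⟨q, hl, hq⟩ | ⟨hl, -⟩
    · exact Or.inl ⟨q, key _ _ hl, hq⟩
    · cases hl
  · intro p hp
    rcases h.down p hp with ⟨q, hl, hq⟩ | ⟨hl, -⟩
    · exact Or.inl ⟨q, key _ _ hl, hq⟩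
    · cases hl

/-- The two ends of a metavariable that is not duplicated carry the same marks. -/
lemma Label.Flow.block_eq {l : Label} {M N : Pos → Prop} (h : l.Flow M N) (u v : Pos)
    (hd : ∀ t q, l.Link (u ++ t) q → q = v ++ t) (hu : ∀ t p, l.Link p (v ++ t) → p = u ++ t)
    (hU : l = .rule .pUp → ∀ t, u ++ t ≠ [.left] ∧ u ++ t ≠ [.right])
    (hD : l = .rule .pDown → ∀ t, v ++ t ≠ [.left] ∧ v ++ t ≠ [.right]) :
    (fun t => M (u ++ t)) = fun t => N (v ++ t) := by
  funext t
  refine propext ⟨fun hM => ?_, fun hN => ?_⟩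
  · rcases h.down _ hM with ⟨q, hl, hq⟩ | ⟨hl, ⟨hp, -⟩ | ⟨hp, -⟩⟩
    · rwa [hd t q hl] at hq
    · exact absurd hp (hU hl t).1
    · exact absurd hp (hU hl t).2
  · rcases h.up _ hN with ⟨p, hl, hp⟩ | ⟨hl, ⟨hp, -⟩ | ⟨hp, -⟩⟩
    · rwa [hu t p hl] at hp
    · exact absurd hp (hD hl t).1
    · exact absurd hp (hD hl t).2

lemma Label.Flow.val_eq_of_eqn {e : Eqn} {W Z : Struct} {M N : Pos → Prop}
    (h : (Label.eqn e).Flow M N) (hi : e.Inst W Z) : W.val M = Z.val N := by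
  -- Every metavariable of an equation occurs exactly once on each side, so its marks are
  -- transported unchanged.
  have key : ∀ u v, (u, v) ∈ e.blocks → (fun t => M (u ++ t)) = fun t => N (v ++ t) := by
    intro u v huv
    refine h.block_eq u v ?_ ?_ (by simp) (by simp) <;> clear hi <;> cases e <;>
      simp only [Eqn.blocks, List.mem_cons, List.not_mem_nil, or_false, Prod.mk.injEq] at huv <;>
      revert u v <;>
      simp +contextual [or_imp, forall_and, Link, blocks, modalities, Eqn.blocks]
  cases hi with
  | parAssoc =>
    have h₁ := key [.left, .left] [.left] (by simp [Eqn.blocks])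
    have h₂ := key [.left, .right] [.right, .left] (by simp [Eqn.blocks])
    have h₃ := key [.right] [.right, .right] (by simp [Eqn.blocks])
    simp only [List.cons_append, List.nil_append] at h₁ h₂ h₃
    simp only [Struct.val, h₁, h₂, h₃, parVal_assoc]
  | timesAssoc =>
    have h₁ := key [.left, .left] [.left] (by simp [Eqn.blocks])
    have h₂ := key [.left, .right] [.right, .left] (by simp [Eqn.blocks])
    have h₃ := key [.right] [.right, .right] (by simp [Eqn.blocks])
    simp only [List.cons_append, List.nil_append] at h₁ h₂ h₃
    simp only [Struct.val, h₁, h₂, h₃, timesVal_assoc]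
  | seqAssoc =>
    have h₁ := key [.left, .left] [.left] (by simp [Eqn.blocks])
    have h₂ := key [.left, .right] [.right, .left] (by simp [Eqn.blocks])
    have h₃ := key [.right] [.right, .right] (by simp [Eqn.blocks])
    simp only [List.cons_append, List.nil_append] at h₁ h₂ h₃
    simp only [Struct.val, h₁, h₂, h₃, seqVal_assoc]
  | parComm =>
    have h₁ := key [.left] [.right] (by simp [Eqn.blocks])
    have h₂ := key [.right] [.left] (by simp [Eqn.blocks])
    simp only [List.cons_append, List.nil_append] at h₁ h₂
    simp only [Struct.val, h₁, h₂]
    exact parVal_comm _ _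
  | timesComm =>
    have h₁ := key [.left] [.right] (by simp [Eqn.blocks])
    have h₂ := key [.right] [.left] (by simp [Eqn.blocks])
    simp only [List.cons_append, List.nil_append] at h₁ h₂
    simp only [Struct.val, h₁, h₂]
    exact timesVal_comm _ _
  | parUnit =>
    have h₁ := key [.right] [] (by simp [Eqn.blocks])
    simp only [List.cons_append, List.nil_append] at h₁
    simp only [Struct.val, h₁, zero_parVal]
  | timesUnit =>
    have h₁ := key [.right] [] (by simp [Eqn.blocks])
    simp only [List.cons_append, List.nil_append] at h₁
    simp only [Struct.val, h₁, zero_timesVal]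
  | seqUnitL =>
    have h₁ := key [.right] [] (by simp [Eqn.blocks])
    simp only [List.cons_append, List.nil_append] at h₁
    simp only [Struct.val, h₁, zero_seqVal]
  | seqUnitR =>
    have h₁ := key [.left] [] (by simp [Eqn.blocks])
    simp only [List.cons_append, List.nil_append] at h₁
    simp only [Struct.val, h₁, seqVal_zero]

/-! ### Values and the modal rules -/

lemma flow_pDown_le {m n k : Prop} (hm : m → n) (hn : n → m ∨ k) (hk : k → n) (r t : SignType) :
    bangVal m (parVal r t) ≤ parVal (bangVal n r) (questVal k t) := by
  have h₁ : ∀ r t : SignType, timesVal 1 (parVal r t) ≤ parVal (timesVal 1 r) t := by decide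
  have h₂ : ∀ r t : SignType,
      timesVal 1 (parVal r t) ≤ parVal (timesVal 1 r) (parVal (-1) t) := by decide
  -- The cycle only turns here (`n` and `k` without `m`): the new values `1` and `-1` are introduced
  -- like a pair of dual atoms.
  have h₃ : ∀ r t : SignType, parVal r t ≤ parVal (timesVal 1 r) (parVal (-1) t) := by decide
  unfold bangVal questVal
  split_ifs <;> tauto

lemma flow_pUp_le {m n k : Prop} (hm : m → n) (hn : n → m ∨ k) (hk : k → n) (r t : SignType) :
    timesVal (questVal n t) (bangVal k r) ≤ questVal m (timesVal t r) := by
  have h₁ : ∀ r t : SignType, timesVal (parVal (-1) t) r ≤ parVal (-1) (timesVal t r) := by decide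
  have h₂ : ∀ r t : SignType,
      timesVal (parVal (-1) t) (timesVal 1 r) ≤ parVal (-1) (timesVal t r) := by decide
  -- The dual turn: marks on both modalities of the contractum and none on the redex, as in an
  -- interaction cut.
  have h₃ : ∀ r t : SignType,
      timesVal (parVal (-1) t) (timesVal 1 r) ≤ timesVal t r := by decide
  unfold bangVal questVal
  split_ifs <;> tauto

/-- For `b↑` with marks only in the copy outside the `!`: the factor `1` of a marked `!` acts
equally well from the neighbouring position. -/
lemma timesVal_bangVal_zero {m : Prop} (r : SignType) :
    timesVal (bangVal m 0) r = bangVal m r := by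
  unfold bangVal
  split_ifs
  · rw [timesVal_zero]
  · exact zero_timesVal r

lemma parVal_questVal_zero {m : Prop} (r : SignType) :
    parVal (questVal m 0) r = questVal m r := by
  unfold questVal
  split_ifs
  · rw [parVal_zero]
  · exact zero_parVal r

/-- Multiplying by `1` is idempotent, so for `g↑` it does not matter which of the two displayed
modalities, or both, are on the cycle. -/
lemma bangVal_bangVal {m n k : Prop} (h : m ↔ n ∨ k) (r : SignType) :
    bangVal n (bangVal k r) = bangVal m r := by
  have h₁ : ∀ r : SignType, timesVal 1 (timesVal 1 r) = timesVal 1 r := by decide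
  unfold bangVal
  split_ifs <;> tauto

lemma questVal_questVal {m n k : Prop} (h : m ↔ n ∨ k) (r : SignType) :
    questVal n (questVal k r) = questVal m r := by
  have h₁ : ∀ r : SignType, parVal (-1) (parVal (-1) r) = parVal (-1) r := by decide
  unfold questVal
  split_ifs <;> tauto

lemma Label.Flow.val_le_of_rule {ρ : Rule} {W Z : Struct} {M N : Pos → Prop}
    (h : (Label.rule ρ).Flow M N) (hf : (Label.rule ρ).NotForked M N) (hi : ρ.Inst W Z) :
    W.val M ≤ Z.val N := by
  have zero (hm : (Label.rule ρ).modalities = []) (hb : (Label.rule ρ).blocks = [])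
      (hU : Label.rule ρ ≠ .rule .pUp) (hD : Label.rule ρ ≠ .rule .pDown) : W.val M ≤ Z.val N := by
    obtain ⟨h₁, h₂⟩ := h.empty hm hb hU hD
    rw [W.val_eq_zero h₁, Z.val_eq_zero h₂]
  have hd := h.down
  have hu := h.up
  cases hi with
  | aiDown | aiUp | eDown | eUp | wDown | wUp => exact zero rfl rfl (by simp) (by simp)
  | s R T U =>
    have h₁ := h.block_eq [.left, .left] [.left, .left]
    have h₂ := h.block_eq [.right] [.left, .right]
    have h₃ := h.block_eq [.left, .right] [.right]
    simp +contextual [Link, blocks, modalities, Rule.blocks, Rule.modalities] at h₁ h₂ h₃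
    simp only [Struct.val, h₁, h₂, h₃]
    exact switch_le _ _ _
  | qDown R T U V =>
    have h₁ := h.block_eq [.left, .left] [.left, .left]
    have h₂ := h.block_eq [.right, .left] [.left, .right]
    have h₃ := h.block_eq [.left, .right] [.right, .left]
    have h₄ := h.block_eq [.right, .right] [.right, .right]
    simp +contextual [Link, blocks, modalities, Rule.blocks, Rule.modalities] at h₁ h₂ h₃ h₄
    simp only [Struct.val, h₁, h₂, h₃, h₄]
    exact seqVal_parVal_le _ _ _ _
  | qUp R T U V =>
    have h₁ := h.block_eq [.left, .left] [.left, .left]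
    have h₂ := h.block_eq [.right, .left] [.left, .right]
    have h₃ := h.block_eq [.left, .right] [.right, .left]
    have h₄ := h.block_eq [.right, .right] [.right, .right]
    simp +contextual [Link, blocks, modalities, Rule.blocks, Rule.modalities] at h₁ h₂ h₃ h₄
    simp only [Struct.val, h₁, h₂, h₃, h₄]
    exact timesVal_seqVal_le _ _ _ _
  | pDown R T =>
    have h₁ := h.block_eq [.inner, .left] [.left, .inner]
    have h₂ := h.block_eq [.inner, .right] [.right, .inner]
    have h₃ := hd []
    have h₄ := hu [.left]
    have h₅ := hu [.right]
    simp +contextual [Link, blocks, modalities, Rule.blocks, Rule.modalities] at h₁ h₂ h₃ h₄ h₅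
    simp only [Struct.val, h₁, h₂]
    exact flow_pDown_le h₃ h₄ h₅ _ _
  | pUp T R =>
    have h₁ := h.block_eq [.left, .inner] [.inner, .left]
    have h₂ := h.block_eq [.right, .inner] [.inner, .right]
    have h₃ := hu []
    have h₄ := hd [.left]
    have h₅ := hd [.right]
    simp +contextual [Link, blocks, modalities, Rule.blocks, Rule.modalities] at h₁ h₂ h₃ h₄ h₅
    simp only [Struct.val, h₁, h₂]
    exact flow_pUp_le h₃ h₄ h₅ _ _
  | bDown T =>
    have hroot : M [.left] = N [] := by
      have h₁ := hd [.left]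
      have h₂ := hu []
      simp [Link, blocks, modalities, Rule.blocks, Rule.modalities] at h₁ h₂
      exact propext ⟨h₁, h₂⟩
    have hblock (t : Pos) : M (.left :: .inner :: t) ∨ M (.right :: t) ↔ N (.inner :: t) := by
      have h₁ := hd (.left :: .inner :: t)
      have h₂ := hd (.right :: t)
      have h₃ := hu (.inner :: t)
      simp [Link, blocks, modalities, Rule.blocks, Rule.modalities] at h₁ h₂ h₃
      tauto
    -- By `hblock` the copies of `T` share out its marks. One copy has none, hence value `0`, and
    -- the other carries exactly the marks of the redex.
    rcases hf.bDown rfl with hn | hn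
    · simp only [hn, false_or] at hblock
      simp only [Struct.val, hroot, T.val_eq_zero hn, hblock, parVal_questVal_zero, le_rfl]
    · simp only [hn, or_false] at hblock
      simp only [Struct.val, hroot, T.val_eq_zero hn, hblock, parVal_zero, le_rfl]
  | bUp R =>
    have hroot : N [.left] = M [] := by
      have h₁ := hu [.left]
      have h₂ := hd []
      simp [Link, blocks, modalities, Rule.blocks, Rule.modalities] at h₁ h₂
      exact propext ⟨h₁, h₂⟩
    have hblock (t : Pos) : N (.left :: .inner :: t) ∨ N (.right :: t) ↔ M (.inner :: t) := by
      have h₁ := hu (.left :: .inner :: t)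
      have h₂ := hu (.right :: t)
      have h₃ := hd (.inner :: t)
      simp [Link, blocks, modalities, Rule.blocks, Rule.modalities] at h₁ h₂ h₃
      tauto
    rcases hf.bUp rfl with hn | hn
    · simp only [hn, false_or] at hblock
      simp only [Struct.val, hroot, R.val_eq_zero hn, hblock, timesVal_bangVal_zero, le_rfl]
    · simp only [hn, or_false] at hblock
      simp only [Struct.val, hroot, R.val_eq_zero hn, hblock, timesVal_zero, le_rfl]
  | gDown T =>
    have h₁ := h.block_eq [.inner, .inner] [.inner]
    have h₂ := hd []
    have h₃ := hd [.inner]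
    have h₄ := hu []
    simp +contextual [Link, blocks, modalities, Rule.blocks, Rule.modalities] at h₁ h₂ h₃ h₄
    simp only [Struct.val, h₁]
    exact (questVal_questVal ⟨h₄, fun hm => hm.elim h₂ h₃⟩ _).le
  | gUp R =>
    have h₁ := h.block_eq [.inner] [.inner, .inner]
    have h₂ := hu []
    have h₃ := hu [.inner]
    have h₄ := hd []
    simp +contextual [Link, blocks, modalities, Rule.blocks, Rule.modalities] at h₁ h₂ h₃ h₄
    simp only [Struct.val, h₁]
    exact (bangVal_bangVal ⟨h₄, fun hm => hm.elim h₂ h₃⟩ _).ge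

lemma Label.Flow.val_le {l : Label} {W Z : Struct} {M N : Pos → Prop} (h : l.Flow M N)
    (hf : l.NotForked M N) (hi : l.Inst W Z) : W.val M ≤ Z.val N := by
  cases l with
  | rule ρ => exact h.val_le_of_rule hf hi
  | eqn e => exact (h.val_eq_of_eqn hi).le
  | eqnSymm e => exact (h.eqnSymm.val_eq_of_eqn hi).ge

/-! ### The cycle -/

lemma Ctx.subAt_fill (C : Ctx) (Z : Struct) (p : Pos) :
    (C.fill Z).subAt (C.path ++ p) = Z.subAt p := by
  induction C with
  | hole => rfl
  | _ => simpa [fill, path, Struct.subAt]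

lemma Inference.subAt_pDown {P Q : Struct} (ρ : Inference P Q) (hl : ρ.label = .rule .pDown) :
    (∃ R, Q.subAt (ρ.ctx.path ++ [.left]) = some (.bang R)) ∧
      ∃ T, Q.subAt (ρ.ctx.path ++ [.right]) = some (.quest T) := by
  have hi := ρ.inst
  rw [hl] at hi
  have key (p : Pos) : Q.subAt (ρ.ctx.path ++ p) = ρ.redex.subAt p :=
    (congrArg (fun S : Struct => S.subAt (ρ.ctx.path ++ p)) ρ.conclusion_eq).trans (ρ.ctx.subAt_fill _ p)
  rw [key, key]
  clear key
  generalize ρ.contractum = W at hi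
  generalize ρ.redex = Z at hi ⊢
  cases hi
  exact ⟨⟨_, rfl⟩, ⟨_, rfl⟩⟩

lemma Inference.subAt_pUp {P Q : Struct} (ρ : Inference P Q) (hl : ρ.label = .rule .pUp) :
    (∃ T, P.subAt (ρ.ctx.path ++ [.left]) = some (.quest T)) ∧
      ∃ R, P.subAt (ρ.ctx.path ++ [.right]) = some (.bang R) := by
  have hi := ρ.inst
  rw [hl] at hi
  have key (p : Pos) : P.subAt (ρ.ctx.path ++ p) = ρ.contractum.subAt p :=
    (congrArg (fun S : Struct => S.subAt (ρ.ctx.path ++ p)) ρ.premise_eq).trans (ρ.ctx.subAt_fill _ p)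
  rw [key, key]
  clear key
  generalize ρ.contractum = W at hi ⊢
  generalize ρ.redex = Z at hi
  cases hi
  exact ⟨⟨_, rfl⟩, ⟨_, rfl⟩⟩

/-! ### Edges at `!`-vertices and at `?`-vertices -/

variable {Δ : Derivation}

lemma Vertex.IsBang.not_isQuest {v : Vertex Δ} (h : v.IsBang) : ¬ v.IsQuest := by
  rintro ⟨T, hT⟩
  obtain ⟨R, hR⟩ := h
  rw [hR] at hT
  cases hT

lemma Vertex.isBang_or_isQuest (v : Vertex Δ) : v.IsBang ∨ v.IsQuest :=
  exists_or.1 v.isModal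

lemma Vertex.isBang_of_pDown {v : Vertex Δ} {i : Fin Δ.len}
    (hl : (Δ.step i).label = .rule .pDown) (hv : v.line = i.succ)
    (hp : v.pos = (Δ.step i).ctx.path ++ [.left]) : v.IsBang := by
  rw [IsBang, hv, hp]
  exact ((Δ.step i).subAt_pDown hl).1

lemma Vertex.isQuest_of_pDown {v : Vertex Δ} {i : Fin Δ.len}
    (hl : (Δ.step i).label = .rule .pDown) (hv : v.line = i.succ)
    (hp : v.pos = (Δ.step i).ctx.path ++ [.right]) : v.IsQuest := by
  rw [IsQuest, hv, hp]
  exact ((Δ.step i).subAt_pDown hl).2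

lemma Vertex.isQuest_of_pUp {v : Vertex Δ} {i : Fin Δ.len}
    (hl : (Δ.step i).label = .rule .pUp) (hv : v.line = i.castSucc)
    (hp : v.pos = (Δ.step i).ctx.path ++ [.left]) : v.IsQuest := by
  rw [IsQuest, hv, hp]
  exact ((Δ.step i).subAt_pUp hl).1

lemma Vertex.isBang_of_pUp {v : Vertex Δ} {i : Fin Δ.len}
    (hl : (Δ.step i).label = .rule .pUp) (hv : v.line = i.castSucc)
    (hp : v.pos = (Δ.step i).ctx.path ++ [.right]) : v.IsBang := by
  rw [IsBang, hv, hp]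
  exact ((Δ.step i).subAt_pUp hl).2

/-- The kind of a vertex fixes the side on which the path proceeds: a `!`-vertex is left through the
step above its line and entered through the step below, a `?`-vertex the other way round. A turn
stays within the line but belongs to that same step. -/
lemma Edge.of_isBang_source {u v : Vertex Δ} (e : Edge Δ u v) (hu : u.IsBang) :
    ∃ i : Fin Δ.len, u.line = i.succ ∧
      ((v.line = i.castSucc ∧ (Δ.step i).Link v.pos u.pos) ∨
        ((Δ.step i).label = .rule .pDown ∧ v.line = i.succ ∧
          u.pos = (Δ.step i).ctx.path ++ [.left] ∧ v.pos = (Δ.step i).ctx.path ++ [.right])) := by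
  cases e with
  | up i _ _ hul hvl hub hvb h => exact ⟨i, hul, .inl ⟨hvl, h⟩⟩
  | down i _ _ hul hvl huq hvq h => exact absurd huq hu.not_isQuest
  | flipDown i _ _ hl hul hvl hup hvp => exact ⟨i, hul, .inr ⟨hl, hvl, hup, hvp⟩⟩
  | flipUp i _ _ hl hul hvl hup hvp => exact absurd (Vertex.isQuest_of_pUp hl hul hup) hu.not_isQuest

lemma Edge.of_isQuest_source {u v : Vertex Δ} (e : Edge Δ u v) (hu : u.IsQuest) :
    ∃ i : Fin Δ.len, u.line = i.castSucc ∧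
      ((v.line = i.succ ∧ (Δ.step i).Link u.pos v.pos) ∨
        ((Δ.step i).label = .rule .pUp ∧ v.line = i.castSucc ∧
          u.pos = (Δ.step i).ctx.path ++ [.left] ∧ v.pos = (Δ.step i).ctx.path ++ [.right])) := by
  cases e with
  | up i _ _ hul hvl hub hvb h => exact absurd hu hub.not_isQuest
  | down i _ _ hul hvl huq hvq h => exact ⟨i, hul, .inl ⟨hvl, h⟩⟩
  | flipDown i _ _ hl hul hvl hup hvp =>
    exact absurd hu (Vertex.isBang_of_pDown hl hul hup).not_isQuest
  | flipUp i _ _ hl hul hvl hup hvp => exact ⟨i, hul, .inr ⟨hl, hvl, hup, hvp⟩⟩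

lemma Edge.of_isBang_target {u v : Vertex Δ} (e : Edge Δ u v) (hv : v.IsBang) :
    ∃ i : Fin Δ.len, v.line = i.castSucc ∧
      ((u.line = i.succ ∧ (Δ.step i).Link v.pos u.pos) ∨
        ((Δ.step i).label = .rule .pUp ∧ u.line = i.castSucc ∧
          u.pos = (Δ.step i).ctx.path ++ [.left] ∧ v.pos = (Δ.step i).ctx.path ++ [.right])) := by
  cases e with
  | up i _ _ hul hvl hub hvb h => exact ⟨i, hvl, .inl ⟨hul, h⟩⟩
  | down i _ _ hul hvl huq hvq h => exact absurd hvq hv.not_isQuest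
  | flipDown i _ _ hl hul hvl hup hvp =>
    exact absurd (Vertex.isQuest_of_pDown hl hvl hvp) hv.not_isQuest
  | flipUp i _ _ hl hul hvl hup hvp => exact ⟨i, hvl, .inr ⟨hl, hul, hup, hvp⟩⟩

lemma Edge.of_isQuest_target {u v : Vertex Δ} (e : Edge Δ u v) (hv : v.IsQuest) :
    ∃ i : Fin Δ.len, v.line = i.succ ∧
      ((u.line = i.castSucc ∧ (Δ.step i).Link u.pos v.pos) ∨
        ((Δ.step i).label = .rule .pDown ∧ u.line = i.succ ∧
          u.pos = (Δ.step i).ctx.path ++ [.left] ∧ v.pos = (Δ.step i).ctx.path ++ [.right])) := by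
  cases e with
  | up i _ _ hul hvl hub hvb h => exact absurd hv hvb.not_isQuest
  | down i _ _ hul hvl huq hvq h => exact ⟨i, hvl, .inl ⟨hul, h⟩⟩
  | flipDown i _ _ hl hul hvl hup hvp => exact ⟨i, hvl, .inr ⟨hl, hul, hup, hvp⟩⟩
  | flipUp i _ _ hl hul hvl hup hvp =>
    exact absurd hv (Vertex.isBang_of_pUp hl hvl hvp).not_isQuest

/-! ### The marks of a cycle -/

namespace FlowCycle

lemma exists_edge_from (c : FlowCycle Δ) (j : Fin (c.length + 1)) :
    ∃ j', Edge Δ (c.vertex j) (c.vertex j') := by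
  induction j using Fin.lastCases with
  | last => exact ⟨_, c.closed ▸ c.edge ⟨0, c.length_pos⟩⟩
  | cast i => exact ⟨_, c.edge i⟩

lemma exists_edge_to (c : FlowCycle Δ) (j : Fin (c.length + 1)) :
    ∃ j', Edge Δ (c.vertex j') (c.vertex j) := by
  induction j using Fin.cases with
  | zero =>
    -- Vertex `0` is also the last one, so the last edge of the path enters it.
    obtain ⟨n, hn⟩ : ∃ n : Fin c.length, n.succ = Fin.last c.length :=
      ⟨⟨c.length - 1, Nat.sub_lt c.length_pos one_pos⟩, Fin.ext (Nat.sub_add_cancel c.length_pos)⟩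
    exact ⟨_, c.closed ▸ hn ▸ c.edge n⟩
  | succ i => exact ⟨_, c.edge i⟩

/-- The cycle has a vertex at position `p` of line `k`. -/
def Mark (c : FlowCycle Δ) (k : Fin (Δ.len + 1)) (p : Pos) : Prop :=
  ∃ j, (c.vertex j).line = k ∧ (c.vertex j).pos = p

lemma mark_vertex (c : FlowCycle Δ) (j : Fin (c.length + 1)) :
    c.Mark (c.vertex j).line (c.vertex j).pos :=
  ⟨j, rfl, rfl⟩

lemma meets_of_mark {c : FlowCycle Δ} {k : Fin (Δ.len + 1)} {p q : Pos} (h : c.Mark k q)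
    (hpq : p <+: q) : c.Meets k p := by
  obtain ⟨j, hj, rfl⟩ := h
  exact ⟨j, hj, hpq⟩

/-- On a cycle every `!`-vertex is left, and every `?`-vertex entered, through a step above its
line; the first line has none. -/
lemma not_mark_zero (c : FlowCycle Δ) (p : Pos) : ¬ c.Mark 0 p := by
  rintro ⟨j, hj, -⟩
  rcases (c.vertex j).isBang_or_isQuest with hb | hq
  · obtain ⟨j', e⟩ := c.exists_edge_from j
    obtain ⟨i, hi, -⟩ := e.of_isBang_source hb
    exact Fin.succ_ne_zero i (hi.symm.trans hj)
  · obtain ⟨j', e⟩ := c.exists_edge_to j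
    obtain ⟨i, hi, -⟩ := e.of_isQuest_target hq
    exact Fin.succ_ne_zero i (hi.symm.trans hj)

lemma not_mark_last (c : FlowCycle Δ) (p : Pos) : ¬ c.Mark (Fin.last _) p := by
  rintro ⟨j, hj, -⟩
  rcases (c.vertex j).isBang_or_isQuest with hb | hq
  · obtain ⟨j', e⟩ := c.exists_edge_to j
    obtain ⟨i, hi, -⟩ := e.of_isBang_target hb
    exact Fin.castSucc_ne_last i (hi.symm.trans hj)
  · obtain ⟨j', e⟩ := c.exists_edge_from j
    obtain ⟨i, hi, -⟩ := e.of_isQuest_source hq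
    exact Fin.castSucc_ne_last i (hi.symm.trans hj)

/-- The neighbour on the cycle reached through step `i` is the predecessor of a `!`-vertex and the
successor of a `?`-vertex. After this choice the orientation of the edges is no longer needed. -/
lemma mark_premise (c : FlowCycle Δ) (i : Fin Δ.len) {p : Pos} (h : c.Mark i.castSucc p) :
    (∃ q, (Δ.step i).Link p q ∧ c.Mark i.succ q) ∨ ((Δ.step i).label = .rule .pUp ∧
      (p = (Δ.step i).ctx.path ++ [.left] ∧ c.Mark i.castSucc ((Δ.step i).ctx.path ++ [.right]) ∨
      p = (Δ.step i).ctx.path ++ [.right] ∧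
        c.Mark i.castSucc ((Δ.step i).ctx.path ++ [.left]))) := by
  obtain ⟨j, hj, rfl⟩ := h
  rcases (c.vertex j).isBang_or_isQuest with hb | hq
  · obtain ⟨j', e⟩ := c.exists_edge_to j
    obtain ⟨i', hi, he⟩ := e.of_isBang_target hb
    obtain rfl : i' = i := Fin.castSucc_injective _ (hi.symm.trans hj)
    rcases he with ⟨hl, he⟩ | ⟨hr, hl, hu, hv⟩
    · exact .inl ⟨_, he, j', hl, rfl⟩
    · exact .inr ⟨hr, .inr ⟨hv, j', hl, hu⟩⟩
  · obtain ⟨j', e⟩ := c.exists_edge_from j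
    obtain ⟨i', hi, he⟩ := e.of_isQuest_source hq
    obtain rfl : i' = i := Fin.castSucc_injective _ (hi.symm.trans hj)
    rcases he with ⟨hl, he⟩ | ⟨hr, hl, hu, hv⟩
    · exact .inl ⟨_, he, j', hl, rfl⟩
    · exact .inr ⟨hr, .inl ⟨hu, j', hl, hv⟩⟩

lemma mark_conclusion (c : FlowCycle Δ) (i : Fin Δ.len) {q : Pos} (h : c.Mark i.succ q) :
    (∃ p, (Δ.step i).Link p q ∧ c.Mark i.castSucc p) ∨ ((Δ.step i).label = .rule .pDown ∧
      (q = (Δ.step i).ctx.path ++ [.left] ∧ c.Mark i.succ ((Δ.step i).ctx.path ++ [.right]) ∨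
      q = (Δ.step i).ctx.path ++ [.right] ∧
        c.Mark i.succ ((Δ.step i).ctx.path ++ [.left]))) := by
  obtain ⟨j, hj, rfl⟩ := h
  rcases (c.vertex j).isBang_or_isQuest with hb | hq
  · obtain ⟨j', e⟩ := c.exists_edge_from j
    obtain ⟨i', hi, he⟩ := e.of_isBang_source hb
    obtain rfl : i' = i := Fin.succ_injective _ (hi.symm.trans hj)
    rcases he with ⟨hl, he⟩ | ⟨hr, hl, hu, hv⟩
    · exact .inl ⟨_, he, j', hl, rfl⟩
    · exact .inr ⟨hr, .inl ⟨hu, j', hl, hv⟩⟩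
  · obtain ⟨j', e⟩ := c.exists_edge_to j
    obtain ⟨i', hi, he⟩ := e.of_isQuest_target hq
    obtain rfl : i' = i := Fin.succ_injective _ (hi.symm.trans hj)
    rcases he with ⟨hl, he⟩ | ⟨hr, hl, hu, hv⟩
    · exact .inl ⟨_, he, j', hl, rfl⟩
    · exact .inr ⟨hr, .inr ⟨hv, j', hl, hu⟩⟩

lemma mark_iff_of_ctx (c : FlowCycle Δ) (i : Fin Δ.len) {p : Pos}
    (hp : ¬ (Δ.step i).ctx.path <+: p) : c.Mark i.castSucc p ↔ c.Mark i.succ p := by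
  constructor
  · intro h
    rcases c.mark_premise i h with ⟨q, ⟨rfl, -⟩ | ⟨p', q', rfl, -⟩, hq⟩ | ⟨-, ⟨rfl, -⟩ | ⟨rfl, -⟩⟩
    · exact hq
    all_goals exact absurd (List.prefix_append _ _) hp
  · intro h
    rcases c.mark_conclusion i h with
      ⟨q, ⟨rfl, -⟩ | ⟨p', q', -, rfl, -⟩, hq⟩ | ⟨-, ⟨rfl, -⟩ | ⟨rfl, -⟩⟩
    · exact hq
    all_goals exact absurd (List.prefix_append _ _) hp

lemma flow (c : FlowCycle Δ) (i : Fin Δ.len) :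
    (Δ.step i).label.Flow (fun p => c.Mark i.castSucc ((Δ.step i).ctx.path ++ p))
      (fun q => c.Mark i.succ ((Δ.step i).ctx.path ++ q)) := by
  constructor
  · intro p hp
    rcases c.mark_premise i hp with ⟨q, ⟨-, hn⟩ | ⟨p', q', hpp, rfl, hl⟩, hq⟩ | ⟨hr, h⟩
    · exact absurd (List.prefix_append _ _) hn
    · obtain rfl := List.append_cancel_left hpp
      exact .inl ⟨q', hl, hq⟩
    · exact .inr ⟨hr, h.imp (.imp List.append_cancel_left id) (.imp List.append_cancel_left id)⟩
  · intro q hq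
    rcases c.mark_conclusion i hq with ⟨p, ⟨rfl, hn⟩ | ⟨p', q', rfl, hqq, hl⟩, hp⟩ | ⟨hr, h⟩
    · exact absurd (List.prefix_append _ _) hn
    · obtain rfl := List.append_cancel_left hqq
      exact .inl ⟨p', hl, hp⟩
    · exact .inr ⟨hr, h.imp (.imp List.append_cancel_left id) (.imp List.append_cancel_left id)⟩

lemma notForked {c : FlowCycle Δ} {i : Fin Δ.len} (h : ¬ c.ForkedBy i) :
    (Δ.step i).label.NotForked (fun p => c.Mark i.castSucc ((Δ.step i).ctx.path ++ p))
      (fun q => c.Mark i.succ ((Δ.step i).ctx.path ++ q)) := by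
  constructor
  · intro hl
    by_contra! hn
    obtain ⟨⟨t, ht⟩, ⟨t', ht'⟩⟩ := hn
    exact h (.inl ⟨hl, meets_of_mark ht (by simp), meets_of_mark ht' (by simp)⟩)
  · intro hl
    by_contra! hn
    obtain ⟨⟨t, ht⟩, ⟨t', ht'⟩⟩ := hn
    exact h (.inr ⟨hl, meets_of_mark ht (by simp), meets_of_mark ht' (by simp)⟩)

lemma Unforked.not_forkedBy {c : FlowCycle Δ} (h : c.Unforked) (i : Fin Δ.len) :
    ¬ c.ForkedBy i := fun hi =>
  Set.eq_empty_iff_forall_notMem.1 ((Set.ncard_eq_zero (Set.toFinite _)).1 h) i hi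

/-- Along a derivation, the coherence value given by an unforked cycle increases. -/
lemma Unforked.monotone_val {c : FlowCycle Δ} (h : c.Unforked) :
    Monotone fun k => (Δ.line k).val (c.Mark k) := by
  refine Fin.monotone_iff_le_succ.2 fun i => ?_
  have key := (Δ.step i).ctx.val_fill_le (fun _ => c.mark_iff_of_ctx i)
    ((c.flow i).val_le (notForked (h.not_forkedBy i)) (Δ.step i).inst)
  rwa [← (Δ.step i).premise_eq, ← (Δ.step i).conclusion_eq] at key

theorem not_unforked (c : FlowCycle Δ) : ¬ c.Unforked := by
  intro h
  have h₀ := (Δ.line 0).val_eq_zero c.not_mark_zero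
  have h₁ := (Δ.line (Fin.last _)).val_eq_zero c.not_mark_last
  -- The value at the line of a vertex is squeezed between the two zeros at the ends.
  have hk : (Δ.line (c.vertex 0).line).val (c.Mark (c.vertex 0).line) = 0 :=
    le_antisymm (h₁ ▸ h.monotone_val (Fin.le_last _)) (h₀ ▸ h.monotone_val (Fin.zero_le _))
  exact Struct.not_mark_of_val_eq_zero hk (c.vertex 0).isModal (c.mark_vertex 0)

end FlowCycle

end SNEL

theorem theorem4p12 :
    ¬ ∃ (Δ : SNEL.Derivation) (c : SNEL.FlowCycle Δ), c.Unforked := by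
  rintro ⟨Δ, c, hc⟩
  exact c.not_unforked hc
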